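/- A Borel graph on a Polish space $X$ is a symmetric irreflexive relation $G$ on $X$ that is a Borel subset of $X \times X$; it is locally finite if every vertex has finite degree. For $F \subseteq X$ let $N_G(F) = \{y \notin F : \exists x \in F,\ x \mathrel{G} y\}$. Let $G$ be a locally finite Borel graph on a Polish space $X$ that is bipartite with bipartition $\{B_0, B_1\}$, i.e. $X$ is the disjoint union of $B_0$ and $B_1$ (which are not required to be Borel), and every edge joins a vertex of $B_0$ to a vertex of $B_1$. Suppose there is $\varepsilon > 0$ such that $|N_G(F)| \geq (1+\varepsilon)|F|$ for every finite set $F$ with $F \subseteq B_0$ or $F \subseteq B_1$. Then there is a comeager Borel set $A \subseteq X$ that is $G$-invariant (a union of connected components of $G$) such that the induced graph $G \restriction A$ has a Borel perfect matching, i.e. there is a set $M$ of edges of $G \restriction A$, Borel as a symmetric relation on $A$, such that each vertex of $A$ is incident to exactly one edge of $M$. -/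

import Mathlib

namespace BorelMatching

variable {X : Type*}

/-- `N_G(F)`: the vertices outside `F` that are adjacent to some vertex of `F`. -/
def nbrs (G : SimpleGraph X) (F : Set X) : Set X :=
  {y | y ∉ F ∧ ∃ x ∈ F, G.Adj x y}

/-- Every vertex has finite degree. -/
def IsLocallyFinite (G : SimpleGraph X) : Prop :=
  ∀ x : X, (G.neighborSet x).Finite

/-- A graph is Borel if its edge relation is a Borel subset of the square of the space. (For a
second countable space with its Borel σ-algebra, the product σ-algebra used here is the Borel
σ-algebra of the product.) -/
def IsBorelGraph [MeasurableSpace X] (G : SimpleGraph X) : Prop :=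
  MeasurableSet {p : X × X | G.Adj p.1 p.2}

/-- `{B₀, B₁}` is a bipartition of `G`: the two sets partition the vertex set, and every edge
joins one of them to the other. -/
def IsBipartition (G : SimpleGraph X) (B₀ B₁ : Set X) : Prop :=
  B₀ ∪ B₁ = Set.univ ∧ G.IsBipartiteWith B₀ B₁

/-- A set of vertices is `G`-invariant if it is a union of connected components of `G`. -/
def IsInvariant (G : SimpleGraph X) (A : Set X) : Prop :=
  ∃ C : Set G.ConnectedComponent, A = ⋃ c ∈ C, c.supp

/-- `G` has a Borel perfect matching: a set of edges of `G`, Borel as a symmetric relation on the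
vertices, such that every vertex is incident to exactly one of these edges. -/
def HasBorelPerfectMatching [MeasurableSpace X] (G : SimpleGraph X) : Prop :=
  ∃ M : G.Subgraph, M.IsPerfectMatching ∧ MeasurableSet {p : X × X | M.Adj p.1 p.2}

end BorelMatching

/-! The matching is built in countably many Borel steps. Step `n` matches all unmatched points of a
Borel set `S n` whose points are more than `4 * k n` apart, keeping Hall's condition and expansion
of large sets on the remaining vertices (`Hall.union_pairsOff`). Hall's condition for the remainder
gives each point a partner whose removal together with it is harmless. Because `S n` is sparse, a
linked set with fewer than `k n` points loses at most one neighbor, so only one removed pair matters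
to it, while a linked set `F` with at least `k n` points loses at most `|F| / k n` neighbors, which
its expansion can absorb. With `1 / k n ≤ ε / 2 ^ (n + 1)` the expansion is never exhausted.

Category ensures that these sparse sets suffice: `exists_separated_sequence` chooses the `S n` so
that, for comeagerly many `x`, they cover the whole component of `x`.

Borel partners require Borel enumerations of the components. These come from Novikov's separation
theorem, which yields a countable Borel cover no member of which contains two neighbors of one
vertex. Quantifiers over a component then become countable. -/

open Set MeasureTheory Topology

namespace BorelMatching

/-! ### Separation of analytic sets. -/

/-- A family of sets is Borel separable if it can be enlarged to a family of Borel sets with empty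
intersection. -/
def BorelSeparable {X : Type*} [MeasurableSpace X] (E : ℕ → Set X) : Prop :=
  ∃ B : ℕ → Set X, (∀ n, MeasurableSet (B n)) ∧ (∀ n, E n ⊆ B n) ∧ ⋂ n, B n = ∅

/-- The image under `f n` of the set of sequences that agree with `y (Nat.pair n ·)` at all
positions `m` with `Nat.pair n m < t`. -/
def cylinderImage {X : Type*} (f : ℕ → (ℕ → ℕ) → X) (y : ℕ → ℕ) (t n : ℕ) : Set X :=
  f n '' {z | ∀ m, Nat.pair n m < t → z m = y (Nat.pair n m)}

/-- Fixing position `t` refines only the cylinder with index `t.unpair.1`, which is the union over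
`d` of its refinements; the other cylinders do not depend on `d`. Hence a union of separating sets
is needed at that index, and intersections serve elsewhere. -/
theorem BorelSeparable.of_update {X : Type*} [MeasurableSpace X] {f : ℕ → (ℕ → ℕ) → X}
    {y : ℕ → ℕ} {t : ℕ}
    (h : ∀ d, BorelSeparable (cylinderImage f (Function.update y t d) (t + 1))) :
    BorelSeparable (cylinderImage f y t) := by
  choose B hB hsub hemp using h
  refine ⟨fun n => if n = t.unpair.1 then ⋃ d, B d n else ⋂ d, B d n, fun n => ?_, fun n => ?_, ?_⟩
  · dsimp only
    split_ifs
    · exact MeasurableSet.iUnion fun d => hB d n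
    · exact MeasurableSet.iInter fun d => hB d n
  · rintro _ ⟨z, hz, rfl⟩
    dsimp only
    split_ifs with hn
    · refine mem_iUnion.2 ⟨z t.unpair.2, hsub _ _ ⟨z, fun m hm => ?_, rfl⟩⟩
      rcases Nat.lt_succ_iff_lt_or_eq.1 hm with hm | hm
      · rw [Function.update_of_ne hm.ne]
        exact hz m hm
      · rw [hm, Function.update_self, ← hm, Nat.unpair_pair]
    · refine mem_iInter.2 fun d => hsub _ _ ⟨z, fun m hm => ?_, rfl⟩
      have hne : Nat.pair n m ≠ t := by
        rintro rfl
        simp at hn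
      rw [Function.update_of_ne hne]
      exact hz m (lt_of_le_of_ne (Nat.lt_succ_iff.1 hm) hne)
  · rw [eq_empty_iff_forall_notMem]
    intro x hx
    rw [mem_iInter] at hx
    have h0 := hx t.unpair.1
    rw [if_pos rfl] at h0
    obtain ⟨d, hd⟩ := mem_iUnion.1 h0
    have : x ∈ ⋂ n, B d n := by
      refine mem_iInter.2 fun n => ?_
      by_cases hn : n = t.unpair.1
      · rw [hn]; exact hd
      · have h1 := hx n
        rw [if_neg hn] at h1
        exact mem_iInter.1 h1 d
    rw [hemp] at this
    exact this

theorem exists_cylinder_subset {X : Type*} [TopologicalSpace X] {f : (ℕ → ℕ) → X}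
    (hf : Continuous f) (y : ℕ → ℕ) {U : Set X} (hU : IsOpen U) (hy : f y ∈ U) :
    ∃ N, ∀ z : ℕ → ℕ, (∀ m < N, z m = y m) → f z ∈ U := by
  obtain ⟨s, ⟨x, n, rfl⟩, hys, hsub⟩ :=
    (PiNat.isTopologicalBasis_cylinders fun _ : ℕ => ℕ).exists_subset_of_mem_open
      (show y ∈ f ⁻¹' U from hy) (hU.preimage hf)
  exact ⟨n, fun z hz => hsub fun m hm => (hz m hm).trans (hys m hm)⟩

/-- Novikov's separation theorem. -/
theorem borelSeparable_range {X : Type*} [TopologicalSpace X] [T2Space X] [MeasurableSpace X]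
    [OpensMeasurableSpace X] {f : ℕ → (ℕ → ℕ) → X} (hf : ∀ n, Continuous (f n))
    (hemp : ⋂ n, range (f n) = ∅) : BorelSeparable fun n => range (f n) := by
  by_contra hcon
  have hstep : ∀ (t : ℕ) (y : ℕ → ℕ), ∃ d, ¬ BorelSeparable (cylinderImage f y t) →
      ¬ BorelSeparable (cylinderImage f (Function.update y t d) (t + 1)) := by
    intro t y
    by_contra! h
    exact (h 0).1 (.of_update fun d => (h d).2)
  choose d hd using hstep
  let Y : ℕ → ℕ → ℕ := fun t => Nat.rec (fun _ => 0) (fun t y => Function.update y t (d t y)) t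
  have hY : ∀ t, Y (t + 1) = Function.update (Y t) t (d t (Y t)) := fun _ => rfl
  have hns : ∀ t, ¬ BorelSeparable (cylinderImage f (Y t) t) := by
    intro t
    induction t with
    | zero =>
      have : cylinderImage f (Y 0) 0 = fun n => range (f n) := by
        funext n
        simp [cylinderImage]
      rwa [this]
    | succ t ih =>
      rw [hY]
      exact hd t _ ih
  -- Position `t` is set at stage `t + 1` and never changed afterwards, so this is the limit of the
  -- `Y t`.
  let y : ℕ → ℕ := fun t => Y (t + 1) t
  have hagree : ∀ t i, i < t → Y t i = y i := by
    intro t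
    induction t with
    | zero => intro i hi; omega
    | succ t ih =>
      intro i hi
      rcases Nat.lt_succ_iff_lt_or_eq.1 hi with hi | rfl
      · rw [hY, Function.update_of_ne hi.ne]
        exact ih i hi
      · rfl
  let p : ℕ → X := fun n => f n fun m => y (Nat.pair n m)
  obtain ⟨i, j, hij⟩ : ∃ i j, p i ≠ p j := by
    by_contra! h
    have : p 0 ∈ ⋂ n, range (f n) := mem_iInter.2 fun n => by
      rw [h 0 n]
      exact mem_range_self _
    rw [hemp] at this
    exact this
  obtain ⟨U, V, hU, hV, hiU, hjV, hdisj⟩ := t2_separation hij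
  obtain ⟨N, hN⟩ := exists_cylinder_subset (hf i) _ hU hiU
  obtain ⟨N', hN'⟩ := exists_cylinder_subset (hf j) _ hV hjV
  have hne : i ≠ j := fun h => hij (by rw [h])
  -- At this stage the first `N` coordinates of sequence `i` and the first `N'` of sequence `j` are
  -- fixed, so the cylinder images lie in `U` and `V`, whose disjointness already separates the
  -- family.
  refine hns (max (Nat.pair i N) (Nat.pair j N'))
    ⟨fun n => if n = i then U else if n = j then V else univ, fun n => ?_, fun n => ?_, ?_⟩
  · dsimp only
    split_ifs
    exacts [hU.measurableSet, hV.measurableSet, MeasurableSet.univ]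
  · rintro _ ⟨z, hz, rfl⟩
    dsimp only
    split_ifs with h1 h2
    · subst h1
      refine hN z fun m hm => ?_
      have := lt_max_of_lt_left (c := Nat.pair j N') (Nat.pair_lt_pair_right n hm)
      rw [hz m this, hagree _ _ this]
    · subst h2
      refine hN' z fun m hm => ?_
      have := lt_max_of_lt_right (b := Nat.pair i N) (Nat.pair_lt_pair_right n hm)
      rw [hz m this, hagree _ _ this]
    · trivial
  · rw [eq_empty_iff_forall_notMem]
    intro x hx
    rw [mem_iInter] at hx
    have h1 := hx i
    have h2 := hx j
    simp only [if_true, if_neg hne.symm] at h1 h2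
    exact hdisj.le_bot ⟨h1, h2⟩

/-- A countable cover by coanalytic sets can be shrunk to a cover by Borel sets. -/
theorem exists_measurable_cover_subset {X : Type*} [TopologicalSpace X] [T2Space X]
    [MeasurableSpace X] [OpensMeasurableSpace X] {C : ℕ → Set X}
    (hC : ∀ n, AnalyticSet (C n)ᶜ) (hcov : ⋃ n, C n = univ) :
    ∃ B : ℕ → Set X, (∀ n, MeasurableSet (B n)) ∧ (∀ n, B n ⊆ C n) ∧ ⋃ n, B n = univ := by
  suffices h : BorelSeparable fun n => (C n)ᶜ by
    obtain ⟨B, hB, hsub, hemp⟩ := h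
    refine ⟨fun n => (B n)ᶜ, fun n => (hB n).compl, fun n => compl_subset_comm.1 (hsub n), ?_⟩
    rw [← compl_iInter, hemp, compl_empty]
  -- The empty set is analytic but not a continuous image of Baire space, so it is treated
  -- separately.
  by_cases h : ∃ n, (C n)ᶜ = ∅
  · obtain ⟨n, hn⟩ := h
    refine ⟨fun m => if m = n then ∅ else univ, fun m => ?_, fun m => ?_, ?_⟩
    · dsimp only
      split_ifs
      exacts [MeasurableSet.empty, MeasurableSet.univ]
    · dsimp only
      split_ifs with hm
      · rw [hm, hn]
      · exact subset_univ _
    · exact subset_empty_iff.1 ((iInter_subset _ n).trans (by simp))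
  · have : ∀ n, ∃ f : (ℕ → ℕ) → X, Continuous f ∧ range f = (C n)ᶜ := fun n => by
      have h1 := hC n
      rw [AnalyticSet] at h1
      exact h1.resolve_left fun h2 => h ⟨n, h2⟩
    choose f hf hfr using this
    simp only [← hfr]
    refine borelSeparable_range hf ?_
    simp only [hfr]
    rw [← compl_iUnion, hcov, compl_univ]

/-! ### Borel enumeration of neighbors and components. -/

theorem exists_nat_basis (X : Type*) [TopologicalSpace X] [SecondCountableTopology X] :
    ∃ U : ℕ → Set X, (∀ n, IsOpen (U n)) ∧
      ∀ (x : X) (O : Set X), IsOpen O → x ∈ O → ∃ n, x ∈ U n ∧ U n ⊆ O := by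
  obtain ⟨b, hbc, -, hb⟩ := TopologicalSpace.exists_countable_basis X
  -- Inserting `∅` makes the basis nonempty, hence enumerable by `ℕ`, even when `X` is empty.
  obtain ⟨U, hU⟩ := (hbc.insert ∅).exists_eq_range (insert_nonempty _ _)
  refine ⟨U, fun n => ?_, fun x O hO hx => ?_⟩
  · have : U n ∈ insert ∅ b := hU ▸ mem_range_self n
    rcases this with h | h
    · rw [h]; exact isOpen_empty
    · exact hb.isOpen h
  · obtain ⟨s, hs, hxs, hsO⟩ := hb.exists_subset_of_mem_open hx hO
    obtain ⟨n, rfl⟩ : s ∈ range U := hU ▸ mem_insert_of_mem _ hs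
    exact ⟨n, hxs, hsO⟩

theorem IsBorelGraph.measurable_adj {X : Type*} [MeasurableSpace X] {G : SimpleGraph X}
    (hG : IsBorelGraph G) {Y : Type*} [MeasurableSpace Y] {f g : Y → X} (hf : Measurable f)
    (hg : Measurable g) : Measurable fun y => G.Adj (f y) (g y) :=
  measurableSet_setOfPred.1 ((hf.prodMk hg) hG)

/-- In a locally finite Borel graph, the vertices are covered by countably many Borel sets none of
which contains two distinct neighbors of a vertex. -/
theorem exists_measurable_cover_neighbors {X : Type*} [TopologicalSpace X] [PolishSpace X]
    [MeasurableSpace X] [BorelSpace X] {G : SimpleGraph X} (hG : IsBorelGraph G)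
    (hfin : IsLocallyFinite G) :
    ∃ B : ℕ → Set X, (∀ n, MeasurableSet (B n)) ∧ ⋃ n, B n = univ ∧
      ∀ n x y z, y ∈ B n → z ∈ B n → G.Adj x y → G.Adj x z → y = z := by
  obtain ⟨U, hU, hbasis⟩ := exists_nat_basis X
  -- The quantifiers over `z` and `x` make `C n` coanalytic, and it must be shrunk to become Borel.
  -- These sets cover because only finitely many points share a neighbor with `y`, and a basic open
  -- set around `y` avoids the others.
  let C : ℕ → Set X := fun n =>
    {y | y ∈ U n ∧ ∀ z ∈ U n, ∀ x, G.Adj x y → G.Adj x z → y = z}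
  have hC : ∀ n, AnalyticSet (C n)ᶜ := by
    intro n
    let P : Set (X × X × X) := {p | p.1 ∈ U n → p.2.1 ∈ U n ∧ G.Adj p.2.2 p.1 ∧
      G.Adj p.2.2 p.2.1 ∧ p.1 ≠ p.2.1}
    have hP : MeasurableSet P := by
      have hmU : Measurable fun x : X => x ∈ U n := measurableSet_setOfPred.1 (hU n).measurableSet
      refine measurableSet_setOfPred.2 (.imp (hmU.comp measurable_fst)
        (.and (hmU.comp (measurable_fst.comp measurable_snd))
        (.and (hG.measurable_adj (by fun_prop) (by fun_prop))
        (.and (hG.measurable_adj (by fun_prop) (by fun_prop)) (.not ?_)))))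
      exact measurableSet_setOfPred.1 (measurableSet_eq_fun (by fun_prop) (by fun_prop))
    convert hP.analyticSet.image_of_continuous continuous_fst using 1
    ext y
    constructor
    · intro hy
      by_cases hyU : y ∈ U n
      · have hy' : ¬ ∀ z ∈ U n, ∀ x, G.Adj x y → G.Adj x z → y = z := fun h => hy ⟨hyU, h⟩
        push Not at hy'
        obtain ⟨z, hz, x, h1, h2, h3⟩ := hy'
        exact ⟨(y, z, x), fun _ => ⟨hz, h1, h2, h3⟩, rfl⟩
      · exact ⟨(y, y, y), fun h => absurd h hyU, rfl⟩
    · rintro ⟨⟨y, z, x⟩, h, rfl⟩ ⟨hyU, hy⟩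
      obtain ⟨hz, h1, h2, h3⟩ := h hyU
      exact h3 (hy z hz x h1 h2)
  have hcov : ⋃ n, C n = univ := by
    refine eq_univ_of_forall fun y => ?_
    have hT : ({z | ∃ x, G.Adj x y ∧ G.Adj x z} \ {y}).Finite := by
      refine Set.Finite.sdiff (((hfin y).biUnion fun x _ => hfin x).subset ?_)
      rintro z ⟨x, h1, h2⟩
      exact mem_biUnion (show x ∈ G.neighborSet y from h1.symm) h2
    obtain ⟨n, hyn, hn⟩ := hbasis y _ hT.isClosed.isOpen_compl (by simp)
    refine mem_iUnion.2 ⟨n, hyn, fun z hz x h1 h2 => ?_⟩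
    by_contra hne
    exact hn hz ⟨⟨x, h1, h2⟩, fun h => hne h.symm⟩
  obtain ⟨B, hB, hsub, hBcov⟩ := exists_measurable_cover_subset hC hcov
  exact ⟨B, hB, hBcov, fun n x y z hy hz h1 h2 => (hsub n hy).2 z (hsub n hz).1 x h1 h2⟩

/-- The edges of a locally finite Borel graph are covered by the graphs of countably many Borel
functions. -/
theorem exists_measurable_neighbor_functions {X : Type*} [TopologicalSpace X] [PolishSpace X]
    [MeasurableSpace X] [BorelSpace X] {G : SimpleGraph X} (hG : IsBorelGraph G)
    (hfin : IsLocallyFinite G) :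
    ∃ g : ℕ → X → X, (∀ n, Measurable (g n)) ∧ (∀ n x, G.Reachable x (g n x)) ∧
      ∀ x y, G.Adj x y → ∃ n, g n x = y := by
  classical
  obtain ⟨B, hB, hcov, hinj⟩ := exists_measurable_cover_neighbors hG hfin
  let g : ℕ → X → X := fun n x => if h : ∃ y ∈ B n, G.Adj x y then h.choose else x
  have hg : ∀ n x y, y ∈ B n → G.Adj x y → g n x = y := by
    intro n x y hy hxy
    have h : ∃ y ∈ B n, G.Adj x y := ⟨y, hy, hxy⟩
    simp only [g, dif_pos h]
    exact hinj n x _ _ h.choose_spec.1 hy h.choose_spec.2 hxy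
  -- The first projection is injective here, since `B n` contains at most one neighbor of each
  -- vertex, and injective Borel images of Borel sets are Borel.
  have himage : ∀ n (S : Set X), MeasurableSet S →
      MeasurableSet {x | ∃ y ∈ B n, y ∈ S ∧ G.Adj x y} := by
    intro n S hS
    have hP : MeasurableSet {p : X × X | p.2 ∈ B n ∧ p.2 ∈ S ∧ G.Adj p.1 p.2} :=
      (measurable_snd (hB n)).inter ((measurable_snd hS).inter hG)
    convert hP.image_of_measurable_injOn measurable_fst ?_ using 1
    · ext x
      constructor
      · rintro ⟨y, h1, h2, h3⟩
        exact ⟨(x, y), ⟨h1, h2, h3⟩, rfl⟩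
      · rintro ⟨⟨x, y⟩, ⟨h1, h2, h3⟩, rfl⟩
        exact ⟨y, h1, h2, h3⟩
    · rintro ⟨x, y⟩ ⟨h1, -, h2⟩ ⟨x', y'⟩ ⟨h1', -, h2'⟩ (rfl : x = x')
      exact Prod.ext rfl (hinj n x y y' h1 h1' h2 h2')
  refine ⟨g, fun n S hS => ?_, fun n x => ?_, fun x y hxy => ?_⟩
  · have : g n ⁻¹' S = {x | ∃ y ∈ B n, y ∈ S ∧ G.Adj x y} ∪
        ({x | ∃ y ∈ B n, y ∈ univ ∧ G.Adj x y}ᶜ ∩ S) := by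
      ext x
      by_cases h : ∃ y ∈ B n, G.Adj x y
      · obtain ⟨y, hy, hxy⟩ := h
        simp only [mem_preimage, hg n x y hy hxy, mem_union, mem_inter_iff,
          mem_compl_iff, mem_ofPred_eq]
        constructor
        · exact fun h => Or.inl ⟨y, hy, h, hxy⟩
        · rintro (⟨z, hz, hzS, hxz⟩ | ⟨h, -⟩)
          · rwa [hinj n x y z hy hz hxy hxz]
          · exact absurd ⟨y, hy, trivial, hxy⟩ h
      · simp only [g, mem_preimage, dif_neg h, mem_union, mem_inter_iff,
          mem_compl_iff, mem_ofPred_eq]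
        constructor
        · exact fun hx => Or.inr ⟨fun ⟨y, hy, _, hxy⟩ => h ⟨y, hy, hxy⟩, hx⟩
        · rintro (⟨y, hy, -, hxy⟩ | ⟨-, hx⟩)
          · exact absurd ⟨y, hy, hxy⟩ h
          · exact hx
    rw [this]
    exact (himage n S hS).union ((himage n univ MeasurableSet.univ).compl.inter hS)
  · by_cases h : ∃ y ∈ B n, G.Adj x y
    · obtain ⟨y, hy, hxy⟩ := h
      rw [hg n x y hy hxy]
      exact hxy.reachable
    · simp only [g, dif_neg h]
      exact SimpleGraph.Reachable.refl x
  · obtain ⟨n, hn⟩ := mem_iUnion.1 (hcov ▸ mem_univ y : y ∈ ⋃ n, B n)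
    exact ⟨n, hg n x y hn hxy⟩

/-- The connected components of a locally finite Borel graph are enumerated by countably many Borel
functions. -/
theorem exists_measurable_component_functions {X : Type*} [TopologicalSpace X] [PolishSpace X]
    [MeasurableSpace X] [BorelSpace X] {G : SimpleGraph X} (hG : IsBorelGraph G)
    (hfin : IsLocallyFinite G) :
    ∃ γ : ℕ → X → X, (∀ n, Measurable (γ n)) ∧ (∀ n x, G.Reachable x (γ n x)) ∧
      ∀ x y, G.Reachable x y → ∃ n, γ n x = y := by
  obtain ⟨g, hg, hgr, hadj⟩ := exists_measurable_neighbor_functions hG hfin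
  let γ : List ℕ → X → X := fun w => w.rec id fun n _ f => f ∘ g n
  have hγ : ∀ w, Measurable (γ w) := by
    intro w
    induction w with
    | nil => exact measurable_id
    | cons n w ih => exact ih.comp (hg n)
  have hγr : ∀ w x, G.Reachable x (γ w x) := by
    intro w
    induction w with
    | nil => exact SimpleGraph.Reachable.refl
    | cons n w ih => exact fun x => (hgr n x).trans (ih _)
  have hreach : ∀ x y, G.Walk x y → ∃ w, γ w x = y := by
    intro x y p
    induction p with
    | nil => exact ⟨[], rfl⟩
    | cons h p ih =>
      obtain ⟨w, hw⟩ := ih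
      obtain ⟨n, hn⟩ := hadj _ _ h
      exact ⟨n :: w, by rw [← hw, ← hn]; rfl⟩
  refine ⟨fun n => γ ((Denumerable.eqv (List ℕ)).symm n), fun n => hγ _, fun n => hγr _, fun x y ⟨p⟩ => ?_⟩
  obtain ⟨w, hw⟩ := hreach x y p
  exact ⟨Denumerable.eqv (List ℕ) w, by simp [hw]⟩

/-! ### Graph distance and separated Borel sets. -/

/-- `x` and `y` are at distance at most `r` in `G`. -/
def Within {X : Type*} (G : SimpleGraph X) (r : ℕ) (x y : X) : Prop :=
  ∃ p : G.Walk x y, p.length ≤ r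

section Within

variable {X : Type*} {G : SimpleGraph X}

theorem Within.refl (r : ℕ) (x : X) : Within G r x x := ⟨.nil, Nat.zero_le _⟩

theorem Within.of_adj {x y : X} (h : G.Adj x y) : Within G 1 x y := ⟨h.toWalk, le_rfl⟩

theorem Within.symm {r : ℕ} {x y : X} (h : Within G r x y) : Within G r y x := by
  obtain ⟨p, hp⟩ := h
  exact ⟨p.reverse, by simpa using hp⟩

theorem Within.trans {r s : ℕ} {x y z : X} (h : Within G r x y) (h' : Within G s y z) :
    Within G (r + s) x z := by
  obtain ⟨p, hp⟩ := h
  obtain ⟨q, hq⟩ := h'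
  exact ⟨p.append q, by rw [SimpleGraph.Walk.length_append]; omega⟩

theorem Within.mono {r s : ℕ} (hrs : r ≤ s) {x y : X} (h : Within G r x y) : Within G s x y := by
  obtain ⟨p, hp⟩ := h
  exact ⟨p, hp.trans hrs⟩

theorem Within.reachable {r : ℕ} {x y : X} (h : Within G r x y) : G.Reachable x y := ⟨h.choose⟩

theorem within_zero {x y : X} : Within G 0 x y ↔ x = y := by
  constructor
  · rintro ⟨p, hp⟩
    exact SimpleGraph.Walk.eq_of_length_eq_zero (Nat.le_zero.1 hp)
  · rintro rfl
    exact .refl 0 _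

theorem within_succ {r : ℕ} {x y : X} :
    Within G (r + 1) x y ↔ x = y ∨ ∃ z, G.Adj x z ∧ Within G r z y := by
  constructor
  · rintro ⟨p, hp⟩
    cases p with
    | nil => exact .inl rfl
    | cons h p => exact .inr ⟨_, h, p, by simpa using hp⟩
  · rintro (rfl | ⟨z, h, p, hp⟩)
    · exact .refl _ _
    · exact ⟨.cons h p, by simpa using hp⟩

theorem finite_within (hfin : IsLocallyFinite G) (r : ℕ) (x : X) : {y | Within G r x y}.Finite := by
  induction r generalizing x with
  | zero => exact (finite_singleton x).subset fun y hy => (within_zero.1 hy).symm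
  | succ r ih =>
    refine (((hfin x).biUnion fun z _ => ih z).insert x).subset fun y hy => ?_
    rcases within_succ.1 hy with rfl | ⟨z, hxz, hzy⟩
    · exact mem_insert _ _
    · exact mem_insert_of_mem _ (mem_biUnion (show z ∈ G.neighborSet x from hxz) hzy)

theorem measurableSet_within [MeasurableSpace X] [StandardBorelSpace X] (hG : IsBorelGraph G)
    {γ : ℕ → X → X} (hγ : ∀ n, Measurable (γ n)) (hcomp : ∀ x y, G.Reachable x y → ∃ n, γ n x = y)
    (r : ℕ) : MeasurableSet {p : X × X | Within G r p.1 p.2} := by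
  induction r with
  | zero =>
    simp only [within_zero]
    exact measurableSet_eq_fun measurable_fst measurable_snd
  | succ r ih =>
    have : ∀ p : X × X, Within G (r + 1) p.1 p.2 ↔ p.1 = p.2 ∨
        ∃ n, G.Adj p.1 (γ n p.1) ∧ Within G r (γ n p.1) p.2 := by
      intro p
      rw [within_succ]
      refine or_congr_right ⟨fun ⟨z, h1, h2⟩ => ?_, fun ⟨n, h⟩ => ⟨_, h⟩⟩
      obtain ⟨n, hn⟩ := hcomp _ _ h1.reachable
      exact ⟨n, by rw [hn]; exact ⟨h1, h2⟩⟩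
    simp only [this]
    refine measurableSet_setOfPred.2 (.or (measurableSet_setOfPred.1
      (measurableSet_eq_fun measurable_fst measurable_snd)) (.exists fun n => .and ?_ ?_))
    · exact hG.measurable_adj measurable_fst ((hγ n).comp measurable_fst)
    · exact measurableSet_setOfPred.1
        ((((hγ n).comp measurable_fst).prodMk measurable_snd) ih)

end Within

/-- For each `r`, the vertices of a locally finite Borel graph are covered by countably many Borel
sets in each of which distinct points have distance greater than `r`. -/
theorem exists_measurable_cover_separated {X : Type*} [TopologicalSpace X] [PolishSpace X]
    [MeasurableSpace X] [BorelSpace X] {G : SimpleGraph X} (hG : IsBorelGraph G)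
    (hfin : IsLocallyFinite G) {γ : ℕ → X → X} (hγ : ∀ n, Measurable (γ n))
    (hcomp : ∀ x y, G.Reachable x y → ∃ n, γ n x = y) (r : ℕ) :
    ∃ C : ℕ → Set X, (∀ n, MeasurableSet (C n)) ∧ ⋃ n, C n = univ ∧
      ∀ n, ∀ x ∈ C n, ∀ y ∈ C n, Within G r x y → x = y := by
  obtain ⟨U, hU, hbasis⟩ := exists_nat_basis X
  refine ⟨fun n => {x | x ∈ U n ∧ ∀ i, γ i x ∈ U n → Within G r x (γ i x) → x = γ i x},
    fun n => ?_, ?_, ?_⟩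
  · refine measurableSet_setOfPred.2 (.and (measurableSet_setOfPred.1 (hU n).measurableSet)
      (.forall fun i => .imp (measurableSet_setOfPred.1 (hγ i (hU n).measurableSet)) (.imp ?_ ?_)))
    · exact measurableSet_setOfPred.1 ((measurable_id.prodMk (hγ i))
        (measurableSet_within hG hγ hcomp r))
    · exact measurableSet_setOfPred.1 (measurableSet_eq_fun measurable_id (hγ i))
  · refine eq_univ_of_forall fun x => ?_
    obtain ⟨n, hxn, hn⟩ := hbasis x _
      (((finite_within hfin r x).sdiff (t := {x})).isClosed.isOpen_compl) (by simp)
    refine mem_iUnion.2 ⟨n, hxn, fun i hi hw => ?_⟩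
    by_contra hne
    exact hn hi ⟨hw, fun h => hne h.symm⟩
  · rintro n x ⟨-, hx⟩ y ⟨hy, -⟩ hw
    obtain ⟨i, rfl⟩ := hcomp x y hw.reachable
    exact hx i hy hw

/-! ### Baire category. -/

/-- A Borel set that is non-meager in every nonempty set of a countable basis is comeager. -/
theorem mem_residual_of_not_isMeagre_inter {X : Type*} [TopologicalSpace X]
    [MeasurableSpace X] [BorelSpace X] {U : ℕ → Set X}
    (hbasis : ∀ (x : X) (O : Set X), IsOpen O → x ∈ O → ∃ n, x ∈ U n ∧ U n ⊆ O) {B : Set X}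
    (hB : MeasurableSet B) (h : ∀ n, (U n).Nonempty → ¬ IsMeagre (U n ∩ B)) : B ∈ residual X := by
  -- By the Baire property `Bᶜ` is an open set `V` modulo a meager set; if `V` is nonempty, `B` is
  -- meager in a basic open subset of it.
  obtain ⟨V, hV, hBV⟩ := hB.compl.residualEq_isOpen
  rcases V.eq_empty_or_nonempty with rfl | ⟨x, hx⟩
  · filter_upwards [hBV] with x hx
    by_contra hxB
    exact hx.mp hxB
  · obtain ⟨n, hxn, hn⟩ := hbasis x V hV hx
    refine absurd ?_ (h n ⟨x, hxn⟩)
    show (U n ∩ B)ᶜ ∈ residual X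
    filter_upwards [hBV] with y hy hy'
    exact (hy.mpr (hn hy'.1)) hy'.2

/-- For prescribed distances `f n` there are Borel sets `S n` in which distinct points have
distance greater than `f n` and whose union contains the component of every point of a comeager
invariant Borel set. -/
theorem exists_separated_sequence {X : Type*} [TopologicalSpace X] [PolishSpace X]
    [MeasurableSpace X] [BorelSpace X] {G : SimpleGraph X} (hG : IsBorelGraph G)
    (hfin : IsLocallyFinite G) {γ : ℕ → X → X} (hγ : ∀ n, Measurable (γ n))
    (hcomp : ∀ x y, G.Reachable x y → ∃ n, γ n x = y) (f : ℕ → ℕ) :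
    ∃ S : ℕ → Set X, (∀ n, MeasurableSet (S n)) ∧
      (∀ n, ∀ x ∈ S n, ∀ y ∈ S n, Within G (f n) x y → x = y) ∧
      {x | ∀ y, G.Reachable x y → y ∈ ⋃ n, S n} ∈ residual X ∧
      MeasurableSet {x | ∀ y, G.Reachable x y → y ∈ ⋃ n, S n} := by
  obtain ⟨U, hU, hbasis⟩ := exists_nat_basis X
  choose C hC hcov hsep using exists_measurable_cover_separated hG hfin hγ hcomp
  -- The index `n` codes a pair `(i, k)`. The preimages under `γ i` of the sets `C (f n) c` cover `U
  -- k`, so one of them is non-meager there. Letting `n` run over all pairs, the preimage of the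
  -- union under every `γ i` is comeager.
  have hchoice : ∀ n : ℕ, ∃ c, (U n.unpair.2).Nonempty →
      ¬ IsMeagre (U n.unpair.2 ∩ γ n.unpair.1 ⁻¹' C (f n) c) := by
    intro n
    by_cases hne : (U n.unpair.2).Nonempty
    · by_contra! hcon
      refine not_isMeagre_of_isOpen (hU n.unpair.2) hne ?_
      have : U n.unpair.2 = ⋃ c, U n.unpair.2 ∩ γ n.unpair.1 ⁻¹' C (f n) c := by
        rw [← inter_iUnion, ← preimage_iUnion, hcov, preimage_univ, inter_univ]
      rw [this]
      exact isMeagre_iUnion fun c => (hcon c).2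
    · exact ⟨0, fun h => absurd h hne⟩
  choose c hc using hchoice
  have hS : MeasurableSet (⋃ n, C (f n) (c n)) := MeasurableSet.iUnion fun n => hC _ _
  have hset : {x | ∀ y, G.Reachable x y → y ∈ ⋃ n, C (f n) (c n)} =
      ⋂ i, {x | G.Reachable x (γ i x) → γ i x ∈ ⋃ n, C (f n) (c n)} := by
    ext x
    simp only [mem_ofPred_eq, mem_iInter]
    refine ⟨fun h i => h _, fun h y hy => ?_⟩
    obtain ⟨i, rfl⟩ := hcomp x y hy
    exact h i hy
  have hreach : ∀ i, MeasurableSet {x | G.Reachable x (γ i x)} := by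
    intro i
    have : {x | G.Reachable x (γ i x)} = ⋃ r, {x | Within G r x (γ i x)} := by
      ext x
      simp only [mem_ofPred_eq, mem_iUnion]
      exact ⟨fun ⟨p⟩ => ⟨_, p, le_rfl⟩, fun ⟨_, h⟩ => h.reachable⟩
    rw [this]
    exact MeasurableSet.iUnion fun r =>
      (measurable_id.prodMk (hγ i)) (measurableSet_within hG hγ hcomp r)
  refine ⟨fun n => C (f n) (c n), fun n => hC _ _, fun n => hsep _ _, ?_, ?_⟩
  · rw [hset]
    refine countable_iInter_mem.2 fun i => ?_
    refine Filter.mem_of_superset (mem_residual_of_not_isMeagre_inter hbasis (hγ i hS)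
      fun k hk hm => ?_) fun x hx _ => hx
    have := hc (Nat.pair i k)
    rw [Nat.unpair_pair] at this
    exact this hk (hm.mono (inter_subset_inter_right _ (preimage_mono (subset_iUnion
      (fun n => C (f n) (c n)) _))))
  · rw [hset]
    exact MeasurableSet.iInter fun i => measurableSet_setOfPred.2
      (.imp (measurableSet_setOfPred.1 (hreach i)) (measurableSet_setOfPred.1 (hγ i hS)))

/-! ### Hall's condition, expansion, and removal of separated pairs. -/

section Combinatorics

variable {X : Type*} {G : SimpleGraph X}

/-- A finite set of vertices is linked if it is connected in the graph that joins vertices with a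
common neighbor in `G`. -/
def Linked (G : SimpleGraph X) (F : Finset X) : Prop :=
  ∀ P ⊆ F, P.Nonempty → P ≠ F → ∃ x ∈ P, ∃ y ∈ F, y ∉ P ∧ ∃ z, G.Adj x z ∧ G.Adj y z

/-- The vertices outside `R` that are adjacent to some vertex of `F`. -/
def nbrsOff (G : SimpleGraph X) (F : Finset X) (R : Set X) : Set X :=
  {y | y ∉ R ∧ ∃ x ∈ F, G.Adj x y}

/-- Hall's condition, for linked sets, in the graph induced on the complement of `R`. -/
def Hall (G : SimpleGraph X) (R : Set X) : Prop :=
  ∀ F : Finset X, Linked G F → (∀ x ∈ F, x ∉ R) → F.card ≤ (nbrsOff G F R).ncard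

/-- Linked sets with at least `k` elements outside `R` expand by the factor `1 + ε` in the graph
induced on the complement of `R`. -/
def Expands (G : SimpleGraph X) (ε : ℝ) (k : ℕ) (R : Set X) : Prop :=
  ∀ F : Finset X, Linked G F → (∀ x ∈ F, x ∉ R) → k ≤ F.card →
    (1 + ε) * F.card ≤ (nbrsOff G F R).ncard

theorem finite_nbrsOff (hfin : IsLocallyFinite G) (F : Finset X) (R : Set X) :
    (nbrsOff G F R).Finite := by
  refine (F.finite_toSet.biUnion fun x _ => hfin x).subset ?_
  rintro y ⟨-, x, hx, hxy⟩
  exact mem_biUnion (Finset.mem_coe.2 hx) hxy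

/-- A set that is not linked splits into two parts without common neighbors, so their neighborhoods
are disjoint and the bounds add up. Linked sets therefore suffice to test Hall's condition. -/
theorem Hall.card_le (hfin : IsLocallyFinite G) {R : Set X} (h : Hall G R) (F : Finset X)
    (hF : ∀ x ∈ F, x ∉ R) : F.card ≤ (nbrsOff G F R).ncard := by
  classical
  induction F using Finset.strongInduction with
  | H F ih =>
    by_cases hl : Linked G F
    · exact h F hl hF
    · unfold Linked at hl
      push Not at hl
      obtain ⟨P, hPF, hP, hne, hno⟩ := hl
      have hss : P ⊂ F := Finset.ssubset_iff_subset_ne.2 ⟨hPF, hne⟩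
      have h1 := ih P hss fun x hx => hF x (hPF hx)
      have h2 := ih (F \ P) (Finset.sdiff_ssubset hPF hP) fun x hx => hF x (Finset.sdiff_subset hx)
      have hdisj : Disjoint (nbrsOff G P R) (nbrsOff G (F \ P) R) := by
        rw [Set.disjoint_left]
        rintro z ⟨-, x, hx, hxz⟩ ⟨-, y, hy, hyz⟩
        rw [Finset.mem_sdiff] at hy
        exact hno x hx y hy.1 hy.2 z hxz hyz
      have hsub : nbrsOff G P R ∪ nbrsOff G (F \ P) R ⊆ nbrsOff G F R := by
        rintro z (⟨hz, x, hx, hxz⟩ | ⟨hz, x, hx, hxz⟩)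
        · exact ⟨hz, x, hPF hx, hxz⟩
        · exact ⟨hz, x, Finset.sdiff_subset hx, hxz⟩
      have h3 := ncard_le_ncard hsub (finite_nbrsOff hfin F R)
      rw [ncard_union_eq hdisj (finite_nbrsOff hfin _ R) (finite_nbrsOff hfin _ R)] at h3
      have h4 := Finset.card_sdiff_add_card_eq_card hPF
      omega

theorem Hall.exists_injective (hfin : IsLocallyFinite G) {R : Set X} (h : Hall G R) :
    ∃ f : {x // x ∉ R} → X, Function.Injective f ∧ ∀ x, f x ∉ R ∧ G.Adj x (f x) := by
  classical
  have hf : ∀ x : {x // x ∉ R}, {y | y ∉ R ∧ G.Adj x y}.Finite := fun x =>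
    (hfin x).subset fun y hy => hy.2
  obtain ⟨f, hinj, hmem⟩ := (Finset.all_card_le_biUnion_card_iff_exists_injective
    fun x => (hf x).toFinset).1 fun s => by
      have h1 := h.card_le hfin (s.map (Function.Embedding.subtype _)) fun x hx => by
        obtain ⟨y, -, rfl⟩ := Finset.mem_map.1 hx
        exact y.2
      rw [Finset.card_map] at h1
      refine h1.trans (le_of_eq ?_)
      rw [← ncard_coe_finset]
      congr 1
      ext y
      simp only [nbrsOff, Finset.mem_map, Function.Embedding.subtype_apply, Finset.coe_biUnion,
        mem_iUnion, Finite.coe_toFinset, mem_ofPred_eq, Finset.mem_coe]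
      constructor
      · rintro ⟨hy, _, ⟨x, hx, rfl⟩, hxy⟩
        exact ⟨x, hx, hy, hxy⟩
      · rintro ⟨x, hx, hy, hxy⟩
        exact ⟨hy, x, ⟨x, hx, rfl⟩, hxy⟩
  exact ⟨f, hinj, fun x => by simpa using hmem x⟩

/-- Hall's theorem gives injections along edges from each side into the other. Schröder–Bernstein
merges them into a bijection along edges, that is, a perfect matching off `R`; `p` sends each vertex
to its partner. -/
theorem Hall.exists_involution (hfin : IsLocallyFinite G) {B₀ B₁ : Set X}
    (hbip : IsBipartition G B₀ B₁) {R : Set X} (h : Hall G R) :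
    ∃ p : X → X, ∀ x, x ∉ R → p x ∉ R ∧ G.Adj x (p x) ∧ p (p x) = x := by
  classical
  obtain ⟨f, hinj, hf⟩ := h.exists_injective hfin
  have h01 : ∀ {x y}, G.Adj x y → x ∈ B₀ → y ∈ B₁ := fun hxy hx => by
    rcases hbip.2.mem_of_adj hxy with h | h
    · exact h.2
    · exact absurd h.1 (Set.disjoint_left.1 hbip.2.disjoint hx)
  have h10 : ∀ {x y}, G.Adj x y → x ∈ B₁ → y ∈ B₀ := fun hxy hx => by
    rcases hbip.2.mem_of_adj hxy with h | h
    · exact absurd hx (Set.disjoint_left.1 hbip.2.disjoint h.1)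
    · exact h.2
  obtain ⟨e, he, hadj⟩ := Function.Embedding.schroeder_bernstein_of_rel
    (α := {x // x ∉ R ∧ x ∈ B₀}) (β := {x // x ∉ R ∧ x ∈ B₁})
    (f := fun x => ⟨f ⟨x, x.2.1⟩, (hf _).1, h01 (hf ⟨x, x.2.1⟩).2 x.2.2⟩)
    (g := fun x => ⟨f ⟨x, x.2.1⟩, (hf _).1, h10 (hf ⟨x, x.2.1⟩).2 x.2.2⟩)
    (fun x y hxy => by
      have := hinj (Subtype.ext_iff.1 hxy)
      exact Subtype.ext (congrArg (fun z : {x // x ∉ R} => (z : X)) this))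
    (fun x y hxy => by
      have := hinj (Subtype.ext_iff.1 hxy)
      exact Subtype.ext (congrArg (fun z : {x // x ∉ R} => (z : X)) this))
    (fun x y => G.Adj x y) (fun x => (hf ⟨x, x.2.1⟩).2) (fun x => (hf ⟨x, x.2.1⟩).2.symm)
  let E := Equiv.ofBijective e he
  have hE : ∀ x : {x // x ∉ R ∧ x ∈ B₀}, G.Adj x (E x) := hadj
  let p : X → X := fun x => if h : x ∉ R ∧ x ∈ B₀ then E ⟨x, h⟩ else
    if h : x ∉ R ∧ x ∈ B₁ then E.symm ⟨x, h⟩ else x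
  have hp0 : ∀ x : {x // x ∉ R ∧ x ∈ B₀}, p x = E x := fun x => dif_pos x.2
  have hp1 : ∀ x : {x // x ∉ R ∧ x ∈ B₁}, p x = E.symm x := fun x => by
    have hx : ¬ ((x : X) ∉ R ∧ (x : X) ∈ B₀) := fun h =>
      Set.disjoint_left.1 hbip.2.disjoint h.2 x.2.2
    simp only [p, dif_neg hx, dif_pos x.2]
  refine ⟨p, fun x hx => ?_⟩
  rcases (hbip.1 ▸ mem_univ x : x ∈ B₀ ∪ B₁) with hx0 | hx1
  · have := hp0 ⟨x, hx, hx0⟩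
    dsimp only at this
    rw [this, hp1, E.symm_apply_apply]
    exact ⟨(E _).2.1, hE ⟨x, hx, hx0⟩, rfl⟩
  · have := hp1 ⟨x, hx, hx1⟩
    dsimp only at this
    rw [this, hp0, E.apply_symm_apply]
    refine ⟨(E.symm _).2.1, ?_, rfl⟩
    have h2 := hE (E.symm ⟨x, hx, hx1⟩)
    rw [E.apply_symm_apply] at h2
    exact h2.symm

/-- Under Hall's condition each vertex has a neighbor such that Hall's condition survives the
removal of both. -/
theorem Hall.exists_partner (hfin : IsLocallyFinite G) {B₀ B₁ : Set X}
    (hbip : IsBipartition G B₀ B₁) {R : Set X} (h : Hall G R) {x : X} (hx : x ∉ R) :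
    ∃ y, y ∉ R ∧ G.Adj x y ∧ Hall G (R ∪ {x, y}) := by
  classical
  -- The partner of `x` in a perfect matching works: `p` still matches all other vertices and so
  -- witnesses Hall's condition for them.
  obtain ⟨p, hp⟩ := h.exists_involution hfin hbip
  refine ⟨p x, (hp x hx).1, (hp x hx).2.1, fun F _ hF => ?_⟩
  have hFR : ∀ z ∈ F, z ∉ R := fun z hz hzR => hF z hz (.inl hzR)
  have hinj : InjOn p F := fun y hy z hz hyz => by
    rw [← (hp y (hFR y hy)).2.2, hyz, (hp z (hFR z hz)).2.2]
  rw [← Finset.card_image_of_injOn hinj, ← ncard_coe_finset]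
  refine ncard_le_ncard ?_ (finite_nbrsOff hfin F _)
  intro y hy
  obtain ⟨z, hz, rfl⟩ := Finset.mem_image.1 (Finset.mem_coe.1 hy)
  obtain ⟨h1, h2, h3⟩ := hp z (hFR z hz)
  refine ⟨?_, z, hz, h2⟩
  rintro (hR | rfl | hxz)
  · exact h1 hR
  · exact hF z hz (.inr (.inr h3.symm))
  · refine hF z hz (.inr (.inl ?_))
    rw [← h3, hxz, (hp x hx).2.2]

-- As long as the ball of radius `2 * j` does not exhaust `F`, linkedness provides a further point
-- of `F` at distance at most 2 from it.
open scoped Classical in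
theorem Linked.min_le_card_within {F : Finset X} (hF : Linked G F) {a : X} (ha : a ∈ F) (j : ℕ) :
    min (j + 1) F.card ≤ (F.filter fun z => Within G (2 * j) a z).card := by
  induction j with
  | zero =>
    refine (min_le_left _ _).trans (Finset.card_pos.2 ⟨a, ?_⟩)
    exact Finset.mem_filter.2 ⟨ha, Within.refl _ _⟩
  | succ j ih =>
    set P := F.filter fun z => Within G (2 * j) a z with hP
    have hsub : P ⊆ F.filter fun z => Within G (2 * (j + 1)) a z := fun z hz => by
      rw [Finset.mem_filter] at hz ⊢
      exact ⟨hz.1, hz.2.mono (by omega)⟩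
    by_cases hPF : P = F
    · refine (min_le_right _ _).trans ?_
      conv_lhs => rw [← hPF]
      exact Finset.card_le_card hsub
    · obtain ⟨x, hx, y, hy, hyP, z, hxz, hyz⟩ := hF P (Finset.filter_subset _ _)
        ⟨a, Finset.mem_filter.2 ⟨ha, .refl _ _⟩⟩ hPF
      have : P ⊂ F.filter fun z => Within G (2 * (j + 1)) a z := by
        refine Finset.ssubset_iff_subset_ne.2 ⟨hsub, fun h => hyP ?_⟩
        rw [h]
        refine Finset.mem_filter.2 ⟨hy, ?_⟩
        exact ((Finset.mem_filter.1 hx).2.trans (.of_adj hxz)).trans (.of_adj hyz.symm)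
      have := Finset.card_lt_card this
      omega

/-- Points of a linked set that are far apart are few. -/
theorem Linked.card_mul_le {F : Finset X} (hF : Linked G F) (j : ℕ) (hj : j + 1 ≤ F.card)
    {ι : Type*} (Y : Finset ι) (a : ι → X) (ha : ∀ i ∈ Y, a i ∈ F)
    (hsep : ∀ i ∈ Y, ∀ i' ∈ Y, Within G (4 * j) (a i) (a i') → i = i') :
    Y.card * (j + 1) ≤ F.card := by
  classical
  -- The balls of radius `2 * j` around the `a i` are disjoint, and each contains at least `j + 1`
  -- points of `F`.
  have h1 : Y.card * (j + 1) ≤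
      (Y.biUnion fun i => F.filter fun z => Within G (2 * j) (a i) z).card := by
    rw [Finset.card_biUnion, ← smul_eq_mul]
    · refine Finset.card_nsmul_le_sum _ _ _ fun i hi => ?_
      have := hF.min_le_card_within (ha i hi) j
      rwa [min_eq_left hj] at this
    · intro i hi i' hi' hne
      rw [Function.onFun, Finset.disjoint_left]
      intro z hz hz'
      refine hne (hsep i hi i' hi' ?_)
      rw [Finset.mem_filter] at hz hz'
      exact (hz.2.trans hz'.2.symm).mono (by omega)
  refine h1.trans (Finset.card_le_card ?_)
  exact Finset.biUnion_subset.2 fun i _ => Finset.filter_subset _ _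

theorem Linked.subset_or_subset {B₀ B₁ : Set X} (hbip : IsBipartition G B₀ B₁) {F : Finset X}
    (hF : Linked G F) : (F : Set X) ⊆ B₀ ∨ (F : Set X) ⊆ B₁ := by
  classical
  by_cases h0 : (F.filter (· ∈ B₀)).Nonempty
  · by_cases h1 : F.filter (· ∈ B₀) = F
    · exact .inl fun x hx => (Finset.mem_filter.1 (h1.symm ▸ Finset.mem_coe.1 hx)).2
    · obtain ⟨x, hx, y, hy, hyP, z, hxz, hyz⟩ := hF _ (Finset.filter_subset _ _) h0 h1
      have hx0 := (Finset.mem_filter.1 hx).2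
      have hd : ∀ w, w ∈ B₀ → w ∉ B₁ := fun w h => Set.disjoint_left.1 hbip.2.disjoint h
      have hy0 : y ∉ B₀ := fun h => hyP (Finset.mem_filter.2 ⟨hy, h⟩)
      rcases hbip.2.mem_of_adj hxz with ⟨h1, h2⟩ | ⟨h1, h2⟩
      · rcases hbip.2.mem_of_adj hyz with ⟨h3, h4⟩ | ⟨h3, h4⟩
        · exact absurd h3 hy0
        · exact absurd h2 (hd _ h4)
      · exact absurd h1 (hd _ hx0)
  · refine .inr fun x hx => ?_
    rcases (hbip.1 ▸ mem_univ x : x ∈ B₀ ∪ B₁) with hx0 | hx1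
    · exact absurd ⟨x, Finset.mem_filter.2 ⟨hx, hx0⟩⟩ h0
    · exact hx1

/-- Neighbors of a linked set in a bipartite graph are not adjacent. -/
theorem Linked.not_adj_of_adj {B₀ B₁ : Set X} (hbip : IsBipartition G B₀ B₁) {F : Finset X}
    (hF : Linked G F) {a b x y : X} (ha : a ∈ F) (hb : b ∈ F) (hax : G.Adj a x) (hby : G.Adj b y) :
    ¬ G.Adj x y := by
  intro hxy
  have hd : ∀ w, w ∈ B₀ → w ∉ B₁ := fun w h => Set.disjoint_left.1 hbip.2.disjoint h
  have h1 := hbip.2.mem_of_adj hax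
  have h2 := hbip.2.mem_of_adj hby
  have h3 := hbip.2.mem_of_adj hxy
  have hdx := hd x
  have hdy := hd y
  have hda := hd a
  have hdb := hd b
  rcases hF.subset_or_subset hbip with h | h
  · have h4 := h ha
    have h5 := h hb
    tauto
  · have h4 := h ha
    have h5 := h hb
    tauto

/-- The vertices in a set `S` outside `R` together with their partners under `e`. -/
def pairsOff (R S : Set X) (e : X → X) : Set X :=
  {y | ∃ x ∈ S, x ∉ R ∧ (y = x ∨ y = e x)}

/-- If the points of `S` are sufficiently far apart, removing them along with suitable partners
preserves Hall's condition, with a small loss of expansion. -/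
theorem Hall.union_pairsOff (hfin : IsLocallyFinite G) {B₀ B₁ : Set X}
    (hbip : IsBipartition G B₀ B₁) {R : Set X} (h : Hall G R) {ε : ℝ} {k : ℕ} (hk : 0 < k)
    (hε : 1 / (k : ℝ) ≤ ε) (hexp : Expands G ε k R) {S : Set X}
    (hS : ∀ x ∈ S, ∀ y ∈ S, Within G (4 * k) x y → x = y) {e : X → X}
    (he : ∀ x ∈ S, x ∉ R → G.Adj x (e x) ∧ Hall G (R ∪ {x, e x})) :
    Hall G (R ∪ pairsOff R S e) ∧ Expands G (ε - 1 / k) k (R ∪ pairsOff R S e) := by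
  classical
  have key : ∀ F : Finset X, Linked G F → (∀ x ∈ F, x ∉ R ∪ pairsOff R S e) →
      F.card ≤ (nbrsOff G F (R ∪ pairsOff R S e)).ncard ∧
      (k ≤ F.card → (1 + (ε - 1 / k)) * F.card ≤ (nbrsOff G F (R ∪ pairsOff R S e)).ncard) := by
    intro F hF hFR
    have hFR' : ∀ x ∈ F, x ∉ R := fun x hx hR => hFR x hx (.inl hR)
    set N := nbrsOff G F R with hN
    set N' := nbrsOff G F (R ∪ pairsOff R S e) with hN'
    have hNfin : N.Finite := finite_nbrsOff hfin F R
    have hN'fin : N'.Finite := finite_nbrsOff hfin F _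
    have hYfin : (N ∩ pairsOff R S e).Finite := hNfin.inter_of_left _
    -- `Y` consists of the neighbors of `F` lost by the removal.
    set Y := hYfin.toFinset with hY
    have hYmem : ∀ y, y ∈ Y ↔ y ∈ N ∧ y ∈ pairsOff R S e := fun y => by simp [hY]
    have hcard : N.ncard = N'.ncard + Y.card := by
      have : N = N' ∪ Y := by
        ext y
        simp only [mem_union, Finset.mem_coe, hYmem, hN, hN', nbrsOff, mem_ofPred_eq]
        by_cases hp : y ∈ pairsOff R S e <;> simp [hp]
      rw [this, ncard_union_eq _ hN'fin Y.finite_toSet, ncard_coe_finset]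
      rw [Set.disjoint_left]
      intro y hy hyY
      exact hy.1 (.inr ((hYmem y).1 (Finset.mem_coe.1 hyY)).2)
    have ha : ∀ y : X, ∃ a, y ∈ Y → a ∈ F ∧ G.Adj a y := fun y => by
      by_cases hy : y ∈ Y
      · obtain ⟨a, h1, h2⟩ := ((hYmem y).1 hy).1.2
        exact ⟨a, fun _ => ⟨h1, h2⟩⟩
      · exact ⟨y, fun h => absurd h hy⟩
    choose a ha using ha
    -- The points of `S` responsible for `y` and `y'` are at distance at most `4 * j + 4 ≤ 4 * k`,
    -- hence equal to one `x`. Then `y` and `y'` lie in the edge `{x, e x}`, and two neighbors of a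
    -- linked set cannot be its two ends.
    have hsep : ∀ j, j + 1 ≤ k → ∀ y ∈ Y, ∀ y' ∈ Y, Within G (4 * j) (a y) (a y') → y = y' := by
      intro j hj y hy y' hy' hw
      obtain ⟨x, hxS, hxR, hxy⟩ := ((hYmem y).1 hy).2
      obtain ⟨x', hxS', hxR', hxy'⟩ := ((hYmem y').1 hy').2
      have h1 : ∀ {u v}, u ∈ S → u ∉ R → (v = u ∨ v = e u) → Within G 1 u v := by
        rintro u v huS huR (rfl | rfl)
        · exact .refl _ _
        · exact .of_adj (he u huS huR).1
      have hxx : x = x' := hS x hxS x' hxS' <|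
        (((((h1 hxS hxR hxy).trans (Within.of_adj (ha y hy).2).symm).trans hw).trans
          (.of_adj (ha y' hy').2)).trans (h1 hxS' hxR' hxy').symm).mono (by omega)
      subst hxx
      have h2 := hF.not_adj_of_adj hbip (ha y hy).1 (ha y' hy').1 (ha y hy).2 (ha y' hy').2
      have h3 := hF.not_adj_of_adj hbip (ha y' hy').1 (ha y hy).1 (ha y' hy').2 (ha y hy).2
      have h4 := (he x hxS hxR).1
      rcases hxy with rfl | rfl <;> rcases hxy' with rfl | rfl
      · rfl
      · exact absurd h4 h2
      · exact absurd h4 h3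
      · rfl
    have hlarge : k ≤ F.card → (1 + (ε - 1 / k)) * F.card ≤ N'.ncard := by
      intro hkF
      have h1 := hexp F hF hFR' hkF
      have h2 := hF.card_mul_le (k - 1) (by omega) Y a (fun y hy => (ha y hy).1)
        (hsep _ (by omega))
      rw [Nat.sub_add_cancel hk] at h2
      have hk' : (0 : ℝ) < k := by exact_mod_cast hk
      have h3 : (Y.card : ℝ) ≤ 1 / k * F.card := by
        rw [div_mul_eq_mul_div, one_mul, le_div_iff₀ hk']
        exact_mod_cast h2
      rw [← hN, hcard] at h1
      push_cast at h1
      linarith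
    refine ⟨?_, hlarge⟩
    rcases le_or_gt k F.card with hkF | hkF
    · have h1 := hlarge hkF
      have : (F.card : ℝ) ≤ N'.ncard := by
        refine le_trans ?_ h1
        nlinarith [(Nat.cast_nonneg F.card : (0 : ℝ) ≤ _)]
      exact_mod_cast this
    · rcases F.eq_empty_or_nonempty with rfl | hne
      · simp
      · have hpos := hne.card_pos
        have h2 := hF.card_mul_le (F.card - 1) (by omega) Y a (fun y hy => (ha y hy).1)
          (hsep _ (by omega))
        rw [Nat.sub_add_cancel hpos] at h2
        -- Taking `j = F.card - 1` gives `Y.card * F.card ≤ F.card`. If a neighbor is lost, a single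
        -- pair is to blame, and `he` gives Hall's condition after removal of that pair.
        have h3 : Y.card ≤ 1 := by
          by_contra! hc
          nlinarith
        rcases Y.eq_empty_or_nonempty with hY0 | ⟨y, hy⟩
        · rw [hY0, Finset.card_empty, add_zero] at hcard
          rw [← hcard]
          exact h F hF hFR'
        · obtain ⟨x, hxS, hxR, hxy⟩ := ((hYmem y).1 hy).2
          have hsub : ({x, e x} : Set X) ⊆ pairsOff R S e := by
            rintro z (rfl | rfl)
            · exact ⟨z, hxS, hxR, .inl rfl⟩
            · exact ⟨x, hxS, hxR, .inr rfl⟩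
          refine ((he x hxS hxR).2 F hF fun z hz hzx => hFR z hz
            (union_subset_union_right R hsub hzx)).trans (ncard_le_ncard ?_ hN'fin)
          rintro z ⟨hz, hzF⟩
          refine ⟨?_, hzF⟩
          rintro (hzR | hzp)
          · exact hz (.inl hzR)
          · have hzY : z ∈ Y := (hYmem z).2 ⟨⟨fun hR => hz (.inl hR), hzF⟩, hzp⟩
            rw [Finset.card_le_one.1 h3 z hzY y hy] at hz
            exact hz (.inr hxy)
  exact ⟨fun F h1 h2 => (key F h1 h2).1, fun F h1 h2 => (key F h1 h2).2⟩

end Combinatorics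

/-! ### Borel definability of Hall's condition. -/

section Measurability

variable {X : Type*} {G : SimpleGraph X}

theorem Linked.reachable {F : Finset X} (hF : Linked G F) {a b : X} (ha : a ∈ F) (hb : b ∈ F) :
    G.Reachable a b := by
  classical
  by_contra hab
  obtain ⟨x, hx, y, hy, hyP, z, hxz, hyz⟩ := hF (F.filter fun c => G.Reachable a c)
    (Finset.filter_subset _ _) ⟨a, Finset.mem_filter.2 ⟨ha, .refl a⟩⟩
    fun h => hab (Finset.mem_filter.1 (h.symm ▸ hb)).2
  exact hyP (Finset.mem_filter.2
    ⟨hy, ((Finset.mem_filter.1 hx).2.trans hxz.reachable).trans hyz.reachable.symm⟩)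

/-- Given Hall's condition off `R`, Hall's condition off `R ∪ {x, y}` is a condition on the component
of `x`, and can be expressed by quantifying over finite sets of indices of an enumeration of that
component. -/
theorem hall_union_pair_iff (hfin : IsLocallyFinite G) {γ : ℕ → X → X}
    (hreach : ∀ n x, G.Reachable x (γ n x)) (hcomp : ∀ x y, G.Reachable x y → ∃ n, γ n x = y)
    {R : Set X} (hR : Hall G R) {x y : X} (hxy : G.Adj x y) :
    Hall G (R ∪ {x, y}) ↔ ∀ W : Finset ℕ,
      (∀ i ∈ W, ∀ j ∈ W, γ i x = γ j x → i = j) →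
      (∀ P ⊆ W, P.Nonempty → P ≠ W → ∃ i ∈ P, ∃ j ∈ W, j ∉ P ∧
        ∃ l, G.Adj (γ i x) (γ l x) ∧ G.Adj (γ j x) (γ l x)) →
      (∀ i ∈ W, γ i x ∉ R ∪ {x, y}) →
      ∃ V : Finset ℕ, V.card = W.card ∧ (∀ i ∈ V, ∀ j ∈ V, γ i x = γ j x → i = j) ∧
        ∀ i ∈ V, γ i x ∉ R ∪ {x, y} ∧ ∃ j ∈ W, G.Adj (γ j x) (γ i x) := by
  classical
  have hu : ∀ y, ∃ n, G.Reachable x y → γ n x = y := fun y => by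
    by_cases h : G.Reachable x y
    · obtain ⟨n, hn⟩ := hcomp x y h
      exact ⟨n, fun _ => hn⟩
    · exact ⟨0, fun h' => absurd h' h⟩
  choose u hu using hu
  have huinj : ∀ F : Finset X, (∀ z ∈ F, G.Reachable x z) → InjOn u F := by
    intro F hF a ha b hb hab
    rw [← hu a (hF a ha), hab, hu b (hF b hb)]
  constructor
  · intro hH W hinj hlink hdisj
    -- `W` indexes a linked set without repetition, and `V` will index equally many of its
    -- neighbors, which expresses the inequality of cardinalities.
    have hlinked : Linked G (W.image fun i => γ i x) := by
      intro P hP hPne hPW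
      obtain ⟨i, hi, j, hj, hjP, l, h1, h2⟩ := hlink (W.filter fun i => γ i x ∈ P)
        (Finset.filter_subset _ _) (by
          obtain ⟨a, ha⟩ := hPne
          obtain ⟨i, hi, rfl⟩ := Finset.mem_image.1 (hP ha)
          exact ⟨i, Finset.mem_filter.2 ⟨hi, ha⟩⟩) (by
          intro h
          refine hPW (hP.antisymm fun a ha => ?_)
          obtain ⟨i, hi, rfl⟩ := Finset.mem_image.1 ha
          rw [← h] at hi
          exact (Finset.mem_filter.1 hi).2)
      exact ⟨γ i x, (Finset.mem_filter.1 hi).2, γ j x, Finset.mem_image_of_mem _ hj,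
        fun h => hjP (Finset.mem_filter.2 ⟨hj, h⟩), γ l x, h1, h2⟩
    have hcard := hH _ hlinked fun a ha => by
      obtain ⟨i, hi, rfl⟩ := Finset.mem_image.1 ha
      exact hdisj i hi
    rw [Finset.card_image_of_injOn (fun i hi j hj => hinj i hi j hj),
      ncard_eq_toFinset_card _ (finite_nbrsOff hfin _ _)] at hcard
    obtain ⟨N, hN, hNcard⟩ := Finset.exists_subset_card_eq hcard
    have hN' : ∀ z ∈ N, z ∉ R ∪ {x, y} ∧ ∃ j ∈ W, G.Adj (γ j x) z := fun z hz => by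
      obtain ⟨h1, a, ha, haz⟩ := (Finite.mem_toFinset _).1 (hN hz)
      obtain ⟨j, hj, rfl⟩ := Finset.mem_image.1 ha
      exact ⟨h1, j, hj, haz⟩
    have hNr : ∀ z ∈ N, G.Reachable x z := fun z hz => by
      obtain ⟨-, j, -, hjz⟩ := hN' z hz
      exact (hreach j x).trans hjz.reachable
    refine ⟨N.image u, ?_, ?_, ?_⟩
    · rw [Finset.card_image_of_injOn (huinj N hNr), hNcard]
    · intro i hi j hj hij
      obtain ⟨a, ha, rfl⟩ := Finset.mem_image.1 hi
      obtain ⟨b, hb, rfl⟩ := Finset.mem_image.1 hj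
      rw [hu a (hNr a ha), hu b (hNr b hb)] at hij
      rw [hij]
    · intro i hi
      obtain ⟨a, ha, rfl⟩ := Finset.mem_image.1 hi
      rw [hu a (hNr a ha)]
      exact hN' a ha
  · intro hT F hF hdisj
    by_cases hFr : ∀ z ∈ F, G.Reachable x z
    · have hγu : ∀ z ∈ F, γ (u z) x = z := fun z hz => hu z (hFr z hz)
      obtain ⟨V, hVcard, hVinj, hV⟩ := hT (F.image u) (by
        intro i hi j hj hij
        obtain ⟨a, ha, rfl⟩ := Finset.mem_image.1 hi
        obtain ⟨b, hb, rfl⟩ := Finset.mem_image.1 hj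
        rw [hγu a ha, hγu b hb] at hij
        rw [hij]) (by
        intro P hP hPne hPF
        obtain ⟨a, ha, b, hb, hbP, z, haz, hbz⟩ := hF (F.filter fun z => u z ∈ P)
          (Finset.filter_subset _ _) (by
            obtain ⟨i, hi⟩ := hPne
            obtain ⟨a, ha, rfl⟩ := Finset.mem_image.1 (hP hi)
            exact ⟨a, Finset.mem_filter.2 ⟨ha, hi⟩⟩) (by
            intro h
            refine hPF (hP.antisymm fun i hi => ?_)
            obtain ⟨a, ha, rfl⟩ := Finset.mem_image.1 hi
            rw [← h] at ha
            exact (Finset.mem_filter.1 ha).2)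
        rw [Finset.mem_filter] at ha
        refine ⟨u a, ha.2, u b, Finset.mem_image_of_mem u hb,
          fun h => hbP (Finset.mem_filter.2 ⟨hb, h⟩), u z, ?_⟩
        rw [hγu a ha.1, hγu b hb, hu z ((hFr b hb).trans hbz.reachable)]
        exact ⟨haz, hbz⟩) (by
        intro i hi
        obtain ⟨a, ha, rfl⟩ := Finset.mem_image.1 hi
        rw [hγu a ha]
        exact hdisj a ha)
      rw [Finset.card_image_of_injOn (huinj F hFr)] at hVcard
      rw [← hVcard, ← Finset.card_image_of_injOn (fun i hi j hj => hVinj i hi j hj),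
        ← ncard_coe_finset]
      refine ncard_le_ncard ?_ (finite_nbrsOff hfin F _)
      intro z hz
      obtain ⟨i, hi, rfl⟩ := Finset.mem_image.1 (Finset.mem_coe.1 hz)
      obtain ⟨h1, j, hj, hji⟩ := hV i hi
      obtain ⟨a, ha, rfl⟩ := Finset.mem_image.1 hj
      rw [hγu a ha] at hji
      exact ⟨h1, a, ha, hji⟩
    -- A linked set lies in a single component. Outside that of `x`, neither `x` nor `y` is among
    -- its neighbors, so `hR` suffices.
    · push Not at hFr
      obtain ⟨b, hb, hxb⟩ := hFr
      refine (hR F hF fun z hz hzR => hdisj z hz (.inl hzR)).trans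
        (ncard_le_ncard ?_ (finite_nbrsOff hfin F _))
      rintro z ⟨hzR, a, ha, haz⟩
      have hza : ¬ G.Reachable x z := fun h =>
        hxb ((h.trans haz.reachable.symm).trans (hF.reachable ha hb))
      refine ⟨?_, a, ha, haz⟩
      rintro (h | rfl | rfl)
      · exact hzR h
      · exact hza (.refl z)
      · exact hza hxy.reachable

/-- In the reformulation by index sets all quantifiers range over countable types. -/
theorem measurableSet_hall_union_pair [MeasurableSpace X] [StandardBorelSpace X]
    (hG : IsBorelGraph G) (hfin : IsLocallyFinite G) {γ : ℕ → X → X}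
    (hγ : ∀ n, Measurable (γ n)) (hreach : ∀ n x, G.Reachable x (γ n x))
    (hcomp : ∀ x y, G.Reachable x y → ∃ n, γ n x = y) {R : Set X} (hRm : MeasurableSet R)
    (hR : Hall G R) :
    MeasurableSet {p : X × X | p.2 ∉ R ∧ G.Adj p.1 p.2 ∧ Hall G (R ∪ {p.1, p.2})} := by
  have hγ' : ∀ n, Measurable fun p : X × X => γ n p.1 := fun n => (hγ n).comp measurable_fst
  have hadj : ∀ i j, Measurable fun p : X × X => G.Adj (γ i p.1) (γ j p.1) := fun i j =>
    hG.measurable_adj (hγ' i) (hγ' j)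
  have heq : ∀ {f g : X × X → X}, Measurable f → Measurable g → Measurable fun p => f p = g p :=
    fun hf hg => measurableSet_setOfPred.1 (measurableSet_eq_fun hf hg)
  have hmem : ∀ n, Measurable fun p : X × X => γ n p.1 ∈ R ∪ {p.1, p.2} := fun n =>
    .or (measurableSet_setOfPred.1 (hγ' n hRm))
      (.or (heq (hγ' n) measurable_fst) (heq (hγ' n) measurable_snd))
  have hinj : ∀ W : Finset ℕ, Measurable fun p : X × X =>
      ∀ i ∈ W, ∀ j ∈ W, γ i p.1 = γ j p.1 → i = j := fun W =>
    .forall fun i => .forall fun _ => .forall fun j => .forall fun _ =>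
      .imp (heq (hγ' i) (hγ' j)) measurable_const
  have hiff := fun p : X × X => and_congr_right (a := p.2 ∉ R) fun _ =>
    and_congr_right fun h : G.Adj p.1 p.2 => hall_union_pair_iff hfin hreach hcomp hR h
  simp only [hiff]
  refine measurableSet_setOfPred.2 (.and (.not (measurableSet_setOfPred.1 (measurable_snd hRm)))
    (.and (hG.measurable_adj measurable_fst measurable_snd) (.forall fun W => .imp (hinj W)
    (.imp ?_ (.imp ?_ (.exists fun V => .and measurable_const (.and (hinj V) ?_)))))))
  · exact .forall fun P => .forall fun _ => .forall fun _ => .forall fun _ => .exists fun i =>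
      .and measurable_const (.exists fun j => .and measurable_const (.and measurable_const
      (.exists fun l => .and (hadj i l) (hadj j l))))
  · exact .forall fun i => .forall fun _ => .not (hmem i)
  · exact .forall fun i => .forall fun _ => .and (.not (hmem i))
      (.exists fun j => .and measurable_const (hadj j i))

end Measurability

/-! ### Construction of the matching. -/

theorem Expands.mono {X : Type*} {G : SimpleGraph X} {ε ε' : ℝ} {k k' : ℕ} {R : Set X}
    (h : Expands G ε k R) (hε : ε' ≤ ε) (hk : k ≤ k') : Expands G ε' k' R := fun F hF hFR hkF =>
  le_trans (by gcongr) (h F hF hFR (hk.trans hkF))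

/-- A Borel set of sufficiently separated vertices can be matched in a Borel way so that the remaining
vertices still satisfy Hall's condition, with a small loss of expansion. -/
theorem exists_measurable_matching_extension {X : Type*} [TopologicalSpace X] [PolishSpace X]
    [MeasurableSpace X] [BorelSpace X] {G : SimpleGraph X} (hG : IsBorelGraph G)
    (hfin : IsLocallyFinite G) {B₀ B₁ : Set X} (hbip : IsBipartition G B₀ B₁) {γ : ℕ → X → X}
    (hγ : ∀ n, Measurable (γ n)) (hreach : ∀ n x, G.Reachable x (γ n x))
    (hcomp : ∀ x y, G.Reachable x y → ∃ n, γ n x = y) {ε : ℝ} {k : ℕ} (hk : 0 < k)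
    (hε : 1 / (k : ℝ) ≤ ε) {R : Set X} (hRm : MeasurableSet R) (hR : Hall G R)
    (hexp : Expands G ε k R) {S : Set X} (hSm : MeasurableSet S)
    (hS : ∀ x ∈ S, ∀ y ∈ S, Within G (4 * k) x y → x = y) :
    ∃ (R' : Set X) (M : X → X → Prop), (MeasurableSet R' ∧ Hall G R' ∧
      Expands G (ε - 1 / k) k R') ∧ R ⊆ R' ∧ S ⊆ R' ∧ MeasurableSet {p : X × X | M p.1 p.2} ∧
      (∀ x y, M x y → M y x ∧ G.Adj x y ∧ x ∈ R' \ R) ∧ ∀ x ∈ R' \ R, ∃! y, M x y := by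
  classical
  -- The disjunct `x ∈ R` makes the search for the least index total; `e x` is meaningful only off
  -- `R`.
  let Q : ℕ → X → Prop := fun n x =>
    (γ n x ∉ R ∧ G.Adj x (γ n x) ∧ Hall G (R ∪ {x, γ n x})) ∨ x ∈ R
  have hQ : ∀ x, ∃ n, Q n x := by
    intro x
    by_cases hx : x ∈ R
    · exact ⟨0, .inr hx⟩
    · obtain ⟨y, hy⟩ := hR.exists_partner hfin hbip hx
      obtain ⟨n, rfl⟩ := hcomp x y hy.2.1.reachable
      exact ⟨n, .inl hy⟩
  let e : X → X := fun x => γ (Nat.find (hQ x)) x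
  have hem : Measurable e := Measurable.find (p := Q) hγ (fun n =>
    ((measurable_id.prodMk (hγ n))
      (measurableSet_hall_union_pair hG hfin hγ hreach hcomp hRm hR)).union hRm) hQ
  have he : ∀ x, x ∉ R → e x ∉ R ∧ G.Adj x (e x) ∧ Hall G (R ∪ {x, e x}) := fun x hx =>
    (Nat.find_spec (hQ x)).resolve_right hx
  have hSe : ∀ x ∈ S, ∀ y ∈ S, x ∉ R → y ∉ R → e x = e y → x = y := by
    intro x hx y hy hxR hyR hxy
    refine hS x hx y hy ?_
    have h1 := Within.of_adj (he x hxR).2.1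
    rw [hxy] at h1
    exact (h1.trans (Within.of_adj (he y hyR).2.1).symm).mono (by omega)
  have hSe' : ∀ x ∈ S, ∀ y ∈ S, x ∉ R → e x ≠ y := by
    rintro x hx y hy hxR rfl
    have h1 := (he x hxR).2.1
    exact h1.ne (hS x hx _ hy ((Within.of_adj h1).mono (by omega)))
  -- A partner finds its point of `S` through the enumeration, so no image under `e` is needed for
  -- measurability.
  have hpairs : pairsOff R S e = (S \ R) ∪ {y | ∃ n, γ n y ∈ S \ R ∧ y = e (γ n y)} := by
    ext y
    constructor
    · rintro ⟨x, hx, hxR, rfl | rfl⟩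
      · exact .inl ⟨hx, hxR⟩
      · obtain ⟨n, hn⟩ := hcomp (e x) x (he x hxR).2.1.symm.reachable
        exact .inr ⟨n, by rw [hn]; exact ⟨hx, hxR⟩, by rw [hn]⟩
    · rintro (⟨hx, hxR⟩ | ⟨n, ⟨hx, hxR⟩, hy⟩)
      · exact ⟨y, hx, hxR, .inl rfl⟩
      · exact ⟨_, hx, hxR, .inr hy⟩
  have hSR : MeasurableSet (S \ R) := hSm.diff hRm
  refine ⟨R ∪ pairsOff R S e, fun x y => (x ∈ S \ R ∧ y = e x) ∨ (y ∈ S \ R ∧ x = e y),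
    ⟨?_, hR.union_pairsOff hfin hbip hk hε hexp hS fun x _ hxR => (he x hxR).2⟩,
    subset_union_left, ?_, ?_, ?_, ?_⟩
  · rw [hpairs]
    exact hRm.union (hSR.union (measurableSet_setOfPred.2 (.exists fun n =>
      .and (measurableSet_setOfPred.1 (hγ n hSR)) (measurableSet_setOfPred.1
        (measurableSet_eq_fun measurable_id (hem.comp (hγ n)))))))
  · intro x hx
    by_cases hxR : x ∈ R
    · exact .inl hxR
    · exact .inr ⟨x, hx, hxR, .inl rfl⟩
  · exact ((measurable_fst hSR).inter (measurableSet_eq_fun measurable_snd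
      (hem.comp measurable_fst))).union ((measurable_snd hSR).inter
        (measurableSet_eq_fun measurable_fst (hem.comp measurable_snd)))
  · rintro x y (⟨⟨hx, hxR⟩, rfl⟩ | ⟨⟨hy, hyR⟩, rfl⟩)
    · exact ⟨.inr ⟨⟨hx, hxR⟩, rfl⟩, (he x hxR).2.1, .inr ⟨x, hx, hxR, .inl rfl⟩, hxR⟩
    · exact ⟨.inl ⟨⟨hy, hyR⟩, rfl⟩, (he y hyR).2.1.symm, .inr ⟨y, hy, hyR, .inr rfl⟩,
        (he y hyR).1⟩
  · rintro z ⟨hz | ⟨x, hx, hxR, rfl | rfl⟩, hzR⟩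
    · exact absurd hz hzR
    · refine ⟨e z, .inl ⟨⟨hx, hxR⟩, rfl⟩, ?_⟩
      rintro y (⟨-, rfl⟩ | ⟨⟨hy, hyR⟩, hzy⟩)
      · rfl
      · exact absurd hzy.symm (hSe' y hy z hx hyR)
    · refine ⟨x, .inr ⟨⟨hx, hxR⟩, rfl⟩, ?_⟩
      rintro y (⟨⟨hy, -⟩, -⟩ | ⟨⟨hy, hyR⟩, hxy⟩)
      · exact absurd rfl (hSe' x hx _ hy hxR)
      · exact hSe y hy x hx hyR hxR hxy.symm

/-- An increasing sequence of sets, with a matching on each successive difference, yields a matching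
on the union. -/
theorem existsUnique_of_increasing {X : Type*} {R : ℕ → Set X} {M : ℕ → X → X → Prop}
    (h0 : R 0 = ∅) (hmono : ∀ n, R n ⊆ R (n + 1))
    (hM : ∀ n x y, M n x y → x ∈ R (n + 1) \ R n)
    (hex : ∀ n, ∀ x ∈ R (n + 1) \ R n, ∃! y, M n x y) {x : X} {n : ℕ} (hx : x ∈ R n) :
    ∃! y, ∃ m, M m x y := by
  classical
  have hmono' := monotone_nat_of_le_succ hmono
  have hfind : ∃ n, x ∈ R n := ⟨n, hx⟩
  obtain ⟨m, hm⟩ : ∃ m, Nat.find hfind = m + 1 := Nat.exists_eq_succ_of_ne_zero fun h => by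
    have := Nat.find_spec hfind
    rw [h, h0] at this
    exact this
  have hxm : x ∈ R (m + 1) \ R m :=
    ⟨hm ▸ Nat.find_spec hfind, Nat.find_min hfind (by omega)⟩
  obtain ⟨y, hy, huniq⟩ := hex m x hxm
  refine ⟨y, ⟨m, hy⟩, fun y' ⟨m', hy'⟩ => huniq y' ?_⟩
  have hxm' := hM _ _ _ hy'
  obtain rfl : m' = m := by
    rcases lt_trichotomy m' m with h | h | h
    · exact absurd (hmono' (show m' + 1 ≤ m from h) hxm'.1) hxm.2
    · exact h
    · exact absurd (hmono' (show m + 1 ≤ m' from h) hxm.1) hxm'.2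
  exact hy'

end BorelMatching

open BorelMatching in
theorem theorem1p3 {X : Type*} [TopologicalSpace X] [PolishSpace X] [MeasurableSpace X]
    [BorelSpace X] (G : SimpleGraph X) (hBorel : BorelMatching.IsBorelGraph G)
    (hfin : BorelMatching.IsLocallyFinite G) (B₀ B₁ : Set X)
    (hbip : BorelMatching.IsBipartition G B₀ B₁)
    (hHall : ∃ ε : ℝ, 0 < ε ∧ ∀ F : Set X, F.Finite → (F ⊆ B₀ ∨ F ⊆ B₁) →
      (1 + ε) * (F.ncard : ℝ) ≤ ((BorelMatching.nbrs G F).ncard : ℝ)) :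
    ∃ A : Set X, MeasurableSet A ∧ A ∈ residual X ∧ BorelMatching.IsInvariant G A ∧
      BorelMatching.HasBorelPerfectMatching (G.induce A) := by
  obtain ⟨ε, hε, hexp⟩ := hHall
  obtain ⟨γ, hγ, hreach, hcomp⟩ := exists_measurable_component_functions hBorel hfin
  -- Step `n` costs `1 / k n ≤ ε / 2 ^ (n + 1)`, so the expansion constant `ε / 2 ^ n` drops at most
  -- to `ε / 2 ^ (n + 1)`.
  let k : ℕ → ℕ := fun n => ⌈2 ^ (n + 1) / ε⌉₊
  have hk : ∀ n, 0 < k n := fun n => Nat.ceil_pos.2 (by positivity)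
  have hk_mono : ∀ n, k n ≤ k (n + 1) := fun n => Nat.ceil_mono
    (div_le_div_of_nonneg_right (pow_le_pow_right₀ one_le_two (Nat.le_succ _)) hε.le)
  have hkε : ∀ n, 1 / (k n : ℝ) ≤ ε / 2 ^ (n + 1) := fun n => by
    rw [← one_div_div (2 ^ (n + 1)) ε]
    exact one_div_le_one_div_of_le (by positivity) (Nat.le_ceil _)
  obtain ⟨S, hSm, hS, hA, hAm⟩ :=
    exists_separated_sequence hBorel hfin hγ hcomp fun n => 4 * k n
  have hexp0 : ∀ F : Finset X, Linked G F →
      (1 + ε) * F.card ≤ ((nbrsOff G F ∅).ncard : ℝ) := fun F hF => by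
    have h := hexp F F.finite_toSet (hF.subset_or_subset hbip)
    rw [ncard_coe_finset] at h
    refine h.trans (Nat.cast_le.2 (ncard_le_ncard ?_ (finite_nbrsOff hfin F ∅)))
    rintro y ⟨-, x, hx, hxy⟩
    exact ⟨notMem_empty y, x, hx, hxy⟩
  let P : ℕ → Set X → Prop := fun n R =>
    MeasurableSet R ∧ Hall G R ∧ Expands G (ε / 2 ^ n) (k n) R
  have hP0 : P 0 ∅ := by
    refine ⟨MeasurableSet.empty, fun F hF _ => ?_, fun F hF _ _ => by simpa using hexp0 F hF⟩
    have h := hexp0 F hF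
    have : (F.card : ℝ) ≤ (nbrsOff G F ∅).ncard := by
      nlinarith [(Nat.cast_nonneg F.card : (0 : ℝ) ≤ _)]
    exact_mod_cast this
  have hstep : ∀ n (R : {R // P n R}), ∃ (R' : {R // P (n + 1) R}) (M : X → X → Prop),
      R.1 ⊆ R'.1 ∧ S n ⊆ R'.1 ∧ MeasurableSet {p : X × X | M p.1 p.2} ∧
      (∀ x y, M x y → M y x ∧ G.Adj x y ∧ x ∈ R'.1 \ R.1) ∧
      ∀ x ∈ R'.1 \ R.1, ∃! y, M x y := by
    rintro n ⟨R, hRm, hR, hRexp⟩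
    have h2 : ε / 2 ^ n = ε / 2 ^ (n + 1) + ε / 2 ^ (n + 1) := by
      rw [pow_succ]
      field_simp
      norm_num
    have h3 : 0 < ε / 2 ^ (n + 1) := by positivity
    have h4 := hkε n
    obtain ⟨R', M, ⟨h1', h2', h3'⟩, h⟩ := exists_measurable_matching_extension hBorel hfin hbip hγ
      hreach hcomp (hk n) (by linarith) hRm hR hRexp (hSm n) (hS n)
    exact ⟨⟨R', h1', h2', h3'.mono (by linarith) (hk_mono n)⟩, M, h⟩
  choose next M hmono hSR hMm hM hMex using hstep
  let R : ∀ n, {R // P n R} := fun n => Nat.rec ⟨∅, hP0⟩ next n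
  -- Every point of `A` lies in some `S n` and is matched by step `n`; invariance of `A` keeps its
  -- partner in `A`.
  let A : Set X := {x | ∀ y, G.Reachable x y → y ∈ ⋃ n, S n}
  have hAreach : ∀ {x y}, x ∈ A → G.Reachable x y → y ∈ A := fun hx hxy z hz =>
    hx z (hxy.trans hz)
  have hmatch : ∀ x ∈ A, ∃! y, ∃ n, M n (R n) x y := by
    intro x hx
    obtain ⟨n, hn⟩ := mem_iUnion.1 (hx x (.refl x))
    exact existsUnique_of_increasing (R := fun n => (R n).1) (M := fun n => M n (R n)) rfl
      (fun n => hmono n (R n)) (fun n x y h => (hM n (R n) x y h).2.2) (fun n => hMex n (R n))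
      (n := n + 1) (hSR n (R n) hn)
  refine ⟨A, hAm, hA, ⟨{c | c.supp ⊆ A}, ?_⟩,
    { verts := univ
      Adj := fun x y => ∃ n, M n (R n) x y
      adj_sub := fun ⟨n, h⟩ => (hM n (R n) _ _ h).2.1
      edge_vert := fun _ => mem_univ _
      symm := ⟨fun _ _ ⟨n, h⟩ => ⟨n, (hM n (R n) _ _ h).1⟩⟩ }, ⟨?_, fun _ => mem_univ _⟩, ?_⟩
  · ext x
    simp only [mem_iUnion]
    constructor
    · intro hx
      refine ⟨G.connectedComponentMk x, fun y hy => hAreach hx ?_, rfl⟩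
      exact (SimpleGraph.ConnectedComponent.exact hy).symm
    · rintro ⟨c, hc, hx⟩
      exact hc hx
  · rintro ⟨x, hx⟩ -
    obtain ⟨y, ⟨n, hy⟩, huniq⟩ := hmatch x hx
    exact ⟨⟨y, hAreach hx (hM n (R n) _ _ hy).2.1.reachable⟩, ⟨n, hy⟩,
      fun z hz => Subtype.ext (huniq z hz)⟩
  · have : MeasurableSet {p : X × X | ∃ n, M n (R n) p.1 p.2} :=
      measurableSet_setOfPred.2 (.exists fun n => measurableSet_setOfPred.1 (hMm n (R n)))
    exact ((measurable_subtype_coe.comp measurable_fst).prodMk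
      (measurable_subtype_coe.comp measurable_snd)) this
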